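/- Let $r\in\mathbb N$ and let $0<\lambda_1<1<\lambda_2$ satisfy $\frac{\lambda_1^r+\lambda_2^r}{2}<1$; let $d_1,d_2\in\mathbb R$. For $\lambda>0$ with $\lambda\lambda_2<1$ let $\mu_{\lambda,\lambda_2}$ be the stationary measure of the iterated function system $f_1(x)=\lambda x+d_1$, $f_2(x)=\lambda_2x+d_2$ with probabilities $(\frac12,\frac12)$, i.e. the unique Borel probability measure $\mu$ on $\mathbb R$ with $\mu=\frac12(f_1)_*\mu+\frac12(f_2)_*\mu$. Let $\nu=(\frac12,\frac12)^{\mathbb N}$ be the Bernoulli measure on $\Sigma=\{1,2\}^{\mathbb N}$; for $i=(i_1,i_2,\dots)\in\Sigma$ put $\lambda_1(\epsilon)=\lambda_1+\epsilon$, $\lambda_2(\epsilon)=\lambda_2$, let $o(m)$ be the number of $1$'s among $i_1,\dots,i_m$, and define $$X(\epsilon)=\sum_{m=0}^\infty \lambda_{i_1}(\epsilon)\cdots\lambda_{i_m}(\epsilon)\,d_{i_{m+1}},\qquad X=X(0),\qquad X^{(j)}=\frac{j!}{\lambda_1^j}\sum_{m=1}^\infty \lambda_{i_1}\cdots\lambda_{i_m}\binom{o(m)}{j}d_{i_{m+1}}\quad(j\ge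 1).$$ Let $\phi\in C^r(\mathbb R)$ be real-valued with $\sup_{\mathbb R}|\phi^{(r)}|<\infty$. Then: (a) For all sufficiently small $|\epsilon|$ the stationary measure $\mu_{\lambda_1+\epsilon,\lambda_2}$ exists and is unique, and $\phi$ is integrable with respect to it. (b) For $\nu$-almost every $i$, the series $X(\epsilon)$ converges for all sufficiently small $|\epsilon|$; for every $j\ge1$ the series $X^{(j)}$ converges, $X(\epsilon)$ is $j$ times differentiable at $\epsilon=0$, and $X^{(j)}=\frac{d^j}{d\epsilon^j}X(\epsilon)|_{\epsilon=0}$; moreover $\epsilon\mapsto\phi(X(\epsilon))$ is $r$ times differentiable at $0$. (c) The function $h(\epsilon)=\int\phi\,d\mu_{\lambda_1+\epsilon,\lambda_2}$ is differentiable at $0$ up to order $r$, and for $l=1,\dots,r$ $$h^{(l)}(0)=\int_\Sigma\frac{d^l}{d\epsilon^l}\bigl(\phi(X(\epsilon))\bigr)\Big|_{\epsilon=0}\,d\nu=\int_\Sigma\ \sum_{k_1+2k_2+\cdots+lk_l=l}L(k_1,\dots,k_l)\,\phi^{(k_1+\cdots+k_l)}(X)\prod_{j=1}^{l}\bigl(X^{(j)}\bigr)^{k_j}\,d\nu,$$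 both integrands being $\nu$-integrable. Here the sum is over all tuples of non-negative integers $(k_1,\dots,k_l)$ with $k_1+2k_2+\cdots+lk_l=l$, and $L(k_1,\dots,k_l)=\dfrac{l!}{k_1!\,(1!)^{k_1}\cdots k_l!\,(l!)^{k_l}}$. -/

import Mathlib

open MeasureTheory Filter Topology
open scoped ENNReal Nat

/-- `μ` is a stationary measure of the probabilistic IFS `{x ↦ l₁ x + d₁, x ↦ l₂ x + d₂}` with
probabilities `(1/2, 1/2)`: a Borel probability measure with
`μ = (1/2) (f₁)_* μ + (1/2) (f₂)_* μ`. -/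
def IsStationaryMeasure (l₁ l₂ d₁ d₂ : ℝ) (μ : Measure ℝ) : Prop :=
  IsProbabilityMeasure μ ∧
    μ = (2⁻¹ : ℝ≥0∞) • μ.map (fun x => l₁ * x + d₁) + (2⁻¹ : ℝ≥0∞) • μ.map (fun x => l₂ * x + d₂)

open Classical in
/-- The stationary measure of the IFS (the zero measure if there is none). -/
noncomputable def stationaryMeasure (l₁ l₂ d₁ d₂ : ℝ) : Measure ℝ :=
  if h : ∃ μ : Measure ℝ, IsStationaryMeasure l₁ l₂ d₁ d₂ μ then h.choose else 0

/-- The Bernoulli measure `(1/2, 1/2)^ℕ` on the sequence space. The letters `1, 2` are written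
`0, 1 : Fin 2`, and the word `i₁ i₂ …` is `ω 0, ω 1, …`. -/
noncomputable def bernoulliMeasure : Measure (ℕ → Fin 2) :=
  Measure.infinitePi (fun _ : ℕ => (PMF.uniformOfFintype (Fin 2)).toMeasure)

/-- The product `l_{i₁} ⋯ l_{i_m}` along the word `ω`. -/
noncomputable def wordProd (l₁ l₂ : ℝ) (m : ℕ) (ω : ℕ → Fin 2) : ℝ :=
  ∏ s ∈ Finset.range m, (![l₁, l₂] : Fin 2 → ℝ) (ω s)

/-- The number of occurrences of the first letter among the first `m` letters of `ω`. -/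
def countFirst (m : ℕ) (ω : ℕ → Fin 2) : ℕ :=
  ((Finset.range m).filter (fun s => ω s = 0)).card

/-- The coding map `X = ∑_{m ≥ 0} l_{i₁} ⋯ l_{i_m} d_{i_{m+1}}`. -/
noncomputable def codingX (l₁ l₂ d₁ d₂ : ℝ) (ω : ℕ → Fin 2) : ℝ :=
  ∑' m : ℕ, wordProd l₁ l₂ m ω * (![d₁, d₂] : Fin 2 → ℝ) (ω m)

/-- The `m`-th term `l_{i₁} ⋯ l_{i_m} (o(m) choose j) d_{i_{m+1}}` of the series of `X^{(j)}`. -/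
noncomputable def formalTerm (l₁ l₂ d₁ d₂ : ℝ) (j m : ℕ) (ω : ℕ → Fin 2) : ℝ :=
  wordProd l₁ l₂ m ω * ((countFirst m ω).choose j : ℝ) * (![d₁, d₂] : Fin 2 → ℝ) (ω m)

/-- `X^{(j)} = (j! / l₁^j) ∑_{m ≥ 1} l_{i₁} ⋯ l_{i_m} (o(m) choose j) d_{i_{m+1}}`. -/
noncomputable def formalX (l₁ l₂ d₁ d₂ : ℝ) (j : ℕ) (ω : ℕ → Fin 2) : ℝ :=
  (j ! : ℝ) / l₁ ^ j * ∑' m : ℕ, formalTerm l₁ l₂ d₁ d₂ j (m + 1) ω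

/-- The tuples `(k₁, …, k_l)` of natural numbers with `k₁ + 2 k₂ + ⋯ + l k_l = l`; the entry
`k_j` is `k ⟨j - 1, _⟩`. (Each entry of such a tuple is at most `l`.) -/
def bruno (l : ℕ) : Finset (Fin l → ℕ) :=
  (Fintype.piFinset (fun _ : Fin l => Finset.range (l + 1))).filter
    (fun k => ∑ j : Fin l, ((j : ℕ) + 1) * k j = l)

/-- `L(k₁, …, k_l) = l! / (k₁! (1!)^{k₁} ⋯ k_l! (l!)^{k_l})`. -/
noncomputable def brunoCoeff (l : ℕ) (k : Fin l → ℕ) : ℝ :=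
  (l ! : ℝ) / ∏ j : Fin l, (((k j)! : ℝ) * (((j : ℕ) + 1)! : ℝ) ^ k j)

/-- The formal `l`-th derivative
`∑ L(k₁, …, k_l) φ^{(k₁ + ⋯ + k_l)}(X) ∏_{j=1}^l (X^{(j)})^{k_j}`. -/
noncomputable def formalDerivative (l₁ l₂ d₁ d₂ : ℝ) (phi : ℝ → ℝ) (l : ℕ) (ω : ℕ → Fin 2) : ℝ :=
  ∑ k ∈ bruno l, brunoCoeff l k * iteratedDeriv (∑ j : Fin l, k j) phi (codingX l₁ l₂ d₁ d₂ ω) *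
    ∏ j : Fin l, formalX l₁ l₂ d₁ d₂ ((j : ℕ) + 1) ω ^ k j

/-- `g` is differentiable at `a` up to order `r`: for each `n < r` the derivative `g^{(n)}` is
differentiable at `a`, and also at all points near `a` when `n < r - 1` (so that the derivatives
`g', …, g^{(r-1)}` exist near `a` and `g^{(r)}` exists at `a`). -/
def DifferentiableUpToAt (r : ℕ) (g : ℝ → ℝ) (a : ℝ) : Prop :=
  ∀ n < r, DifferentiableAt ℝ (iteratedDeriv n g) a ∧
    (n + 1 < r → ∀ᶠ x in 𝓝 a, DifferentiableAt ℝ (iteratedDeriv n g) x)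

/-! The letters are independent, so the product of the first m ratios has r-th moment ((l₁^r +
l₂^r)/2)^m. The hypothesis survives raising l₁ slightly to some b, and summing L^r norms puts W =
∑_m `wordProd b l₂ m` in L^r (`memLp_tsum_wordProd`). This single function dominates everything. Fix
l₁ < a < b. Differentiating the m-th term of X j times in the parameter costs a factor polynomial in
o(m), which (b/a)^{o(m)} absorbs; hence for t in (0, a) the series may be differentiated term by
term and its j-th derivative is at most C_j W (`hasDerivAt_derivX`, `exists_norm_derivX_le`).

As φ^(r) is bounded, φ^(k) grows at most like (1 + |x|)^(r-k). A Faà di Bruno term containing φ^(k)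
has exactly k factors X^(j), so it is at most a constant times (1 + W)^r, which is integrable
(`exists_integrable_bound_derivComp`). Dominated convergence then moves the derivatives through the
integral.

Integrals over words and over the stationary measure agree because the latter is the law of X: X(iω)
= f_i(X(ω)) gives stationarity, and iterating the stationarity equation forces uniqueness, since the
products tend to 0 almost surely (`IsStationaryMeasure.eq_map_codingX`). -/

/-! ### Self-similarity of the Bernoulli measure. -/

/-- The word `i ω₀ ω₁ …`. -/
def wordCons (i : Fin 2) (ω : ℕ → Fin 2) : ℕ → Fin 2
  | 0 => i
  | n + 1 => ω n

@[simp] lemma wordCons_zero (i : Fin 2) (ω : ℕ → Fin 2) : wordCons i ω 0 = i := rfl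

@[simp] lemma wordCons_succ (i : Fin 2) (ω : ℕ → Fin 2) (n : ℕ) :
    wordCons i ω (n + 1) = ω n := rfl

lemma measurable_wordCons_prod :
    Measurable (fun p : Fin 2 × (ℕ → Fin 2) => wordCons p.1 p.2) := by
  refine measurable_pi_lambda _ fun n => ?_
  cases n with
  | zero => exact measurable_fst
  | succ n => exact (measurable_pi_apply n).comp measurable_snd

instance : IsProbabilityMeasure bernoulliMeasure := by
  unfold bernoulliMeasure; infer_instance

lemma bernoulliMeasure_eq_map_wordCons :
    bernoulliMeasure = ((PMF.uniformOfFintype (Fin 2)).toMeasure.prod bernoulliMeasure).map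
      (fun p => wordCons p.1 p.2) := by
  symm
  conv_rhs => rw [bernoulliMeasure]
  refine Measure.eq_infinitePi _ fun s t ht => ?_
  classical
  -- The cylinder is rewritten over an initial segment of indices, padding with `Set.univ`, so that
  -- coordinate 0 can be split off.
  obtain ⟨N, hN⟩ : ∃ N, s ⊆ Finset.range (N + 1) :=
    ⟨s.sup id, fun x hx => Finset.mem_range.2 (Nat.lt_succ_of_le (Finset.le_sup (f := id) hx))⟩
  set t' : ℕ → Set (Fin 2) := fun i => if i ∈ s then t i else Set.univ with ht'
  have ht'm : ∀ i, MeasurableSet (t' i) := fun i => MeasurableSet.of_discrete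
  have hset : (s : Set ℕ).pi t = (Finset.range (N + 1) : Set ℕ).pi t' := by
    ext x
    simp only [Set.mem_pi, ht', Finset.mem_coe]
    constructor
    · intro h i _
      by_cases hi : i ∈ s
      · simpa [hi] using h i hi
      · simp [hi]
    · intro h i hi
      simpa [hi] using h i (hN hi)
  have hprod : ∏ i ∈ s, (PMF.uniformOfFintype (Fin 2)).toMeasure (t i) =
      ∏ i ∈ Finset.range (N + 1), (PMF.uniformOfFintype (Fin 2)).toMeasure (t' i) := by
    rw [← Finset.prod_subset hN]
    · exact Finset.prod_congr rfl fun i hi => by simp [ht', hi]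
    · intro i _ hi
      simp [ht', hi]
  rw [hset, hprod, Measure.map_apply measurable_wordCons_prod
    (MeasurableSet.pi (Finset.countable_toSet _) fun i _ => ht'm i), Finset.prod_range_succ']
  have : (fun p : Fin 2 × (ℕ → Fin 2) => wordCons p.1 p.2) ⁻¹'
      (Finset.range (N + 1) : Set ℕ).pi t' =
      t' 0 ×ˢ (Finset.range N : Set ℕ).pi (fun i => t' (i + 1)) := by
    ext ⟨i, ω⟩
    simp only [Set.mem_preimage, Set.mem_pi, Finset.coe_range, Set.mem_Iio, Set.mem_prod]
    constructor
    · intro h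
      exact ⟨h 0 (by omega), fun j hj => h (j + 1) (by omega)⟩
    · rintro ⟨h0, h⟩ j hj
      cases j with
      | zero => exact h0
      | succ j => exact h j (by omega)
  rw [this, Measure.prod_prod, bernoulliMeasure, Measure.infinitePi_pi _ (fun i _ => ht'm _),
    mul_comm]

/-- Conditioning on the first letter: the form in which self-similarity is used for moments, for
iteration and for stationarity. -/
lemma lintegral_bernoulliMeasure {F : (ℕ → Fin 2) → ℝ≥0∞} (hF : Measurable F) :
    ∫⁻ ω, F ω ∂bernoulliMeasure = 2⁻¹ * ∫⁻ ω, F (wordCons 0 ω) ∂bernoulliMeasure +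
      2⁻¹ * ∫⁻ ω, F (wordCons 1 ω) ∂bernoulliMeasure := by
  conv_lhs => rw [bernoulliMeasure_eq_map_wordCons]
  rw [lintegral_map hF measurable_wordCons_prod,
    lintegral_prod (fun p => F (wordCons p.1 p.2)) (hF.comp measurable_wordCons_prod).aemeasurable,
    lintegral_fintype,
    Fin.sum_univ_two, PMF.toMeasure_apply_singleton _ _ (MeasurableSet.of_discrete),
    PMF.toMeasure_apply_singleton _ _ (MeasurableSet.of_discrete)]
  simp [mul_comm]

/-! ### Moments of the products and of their sum. -/

lemma measurable_wordProd (l₁ l₂ : ℝ) (m : ℕ) : Measurable (wordProd l₁ l₂ m) := by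
  unfold wordProd
  exact Finset.measurable_prod _ fun s _ =>
    (measurable_of_finite (![l₁, l₂] : Fin 2 → ℝ)).comp (measurable_pi_apply s)

lemma measurable_letter (d₁ d₂ : ℝ) (m : ℕ) :
    Measurable (fun ω : ℕ → Fin 2 => (![d₁, d₂] : Fin 2 → ℝ) (ω m)) :=
  (measurable_of_finite (![d₁, d₂] : Fin 2 → ℝ)).comp (measurable_pi_apply m)

lemma wordProd_zero (l₁ l₂ : ℝ) (ω : ℕ → Fin 2) : wordProd l₁ l₂ 0 ω = 1 := by simp [wordProd]

lemma wordProd_wordCons (l₁ l₂ : ℝ) (m : ℕ) (i : Fin 2) (ω : ℕ → Fin 2) :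
    wordProd l₁ l₂ (m + 1) (wordCons i ω) = (![l₁, l₂] : Fin 2 → ℝ) i * wordProd l₁ l₂ m ω := by
  simp [wordProd, Finset.prod_range_succ', mul_comm]

lemma wordProd_pos {l₁ l₂ : ℝ} (h₁ : 0 < l₁) (h₂ : 0 < l₂) (m : ℕ) (ω : ℕ → Fin 2) :
    0 < wordProd l₁ l₂ m ω := by
  refine Finset.prod_pos fun s _ => ?_
  generalize ω s = i
  fin_cases i <;> simpa

lemma lintegral_wordProd_pow {l₁ l₂ : ℝ} (h₁ : 0 < l₁) (h₂ : 0 < l₂) (r m : ℕ) :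
    ∫⁻ ω, ENNReal.ofReal (wordProd l₁ l₂ m ω ^ r) ∂bernoulliMeasure =
      ENNReal.ofReal ((l₁ ^ r + l₂ ^ r) / 2) ^ m := by
  induction m with
  | zero => simp [wordProd_zero]
  | succ m ih =>
    rw [lintegral_bernoulliMeasure ((measurable_wordProd _ _ _).pow_const r).ennreal_ofReal]
    simp only [wordProd_wordCons, mul_pow, Matrix.cons_val_zero, Matrix.cons_val_one]
    simp only [ENNReal.ofReal_mul (pow_pos h₁ r).le, ENNReal.ofReal_mul (pow_pos h₂ r).le]
    rw [lintegral_const_mul _ ((measurable_wordProd _ _ _).pow_const r).ennreal_ofReal,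
      lintegral_const_mul _ ((measurable_wordProd _ _ _).pow_const r).ennreal_ofReal, ih,
      pow_succ, add_div, ENNReal.ofReal_add (by positivity) (by positivity),
      ENNReal.ofReal_div_of_pos two_pos, ENNReal.ofReal_div_of_pos two_pos]
    simp only [ENNReal.div_eq_inv_mul, ENNReal.ofReal_ofNat]
    ring

lemma eLpNorm_wordProd {l₁ l₂ : ℝ} (h₁ : 0 < l₁) (h₂ : 0 < l₂) {r : ℕ} (hr : r ≠ 0) (m : ℕ) :
    eLpNorm (wordProd l₁ l₂ m) r bernoulliMeasure =
      (ENNReal.ofReal ((l₁ ^ r + l₂ ^ r) / 2) ^ (1 / (r : ℝ))) ^ m := by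
  rw [eLpNorm_eq_lintegral_rpow_enorm_toReal (by exact_mod_cast hr) (ENNReal.natCast_ne_top r)]
  have : ∀ ω, ‖wordProd l₁ l₂ m ω‖ₑ ^ (r : ℝ≥0∞).toReal =
      ENNReal.ofReal (wordProd l₁ l₂ m ω ^ r) := fun ω => by
    rw [ENNReal.toReal_natCast, ENNReal.rpow_natCast,
      Real.enorm_eq_ofReal (wordProd_pos h₁ h₂ m ω).le,
      ENNReal.ofReal_pow (wordProd_pos h₁ h₂ m ω).le]
  simp only [this]
  rw [lintegral_wordProd_pow h₁ h₂, ENNReal.toReal_natCast, ← ENNReal.rpow_natCast,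
    ← ENNReal.rpow_natCast, ← ENNReal.rpow_mul, ← ENNReal.rpow_mul, mul_comm]

lemma tsum_eLpNorm_wordProd_ne_top {l₁ l₂ : ℝ} (h₁ : 0 < l₁) (h₂ : 0 < l₂) {r : ℕ} (hr : r ≠ 0)
    (h : (l₁ ^ r + l₂ ^ r) / 2 < 1) :
    ∑' m, eLpNorm (wordProd l₁ l₂ m) r bernoulliMeasure ≠ ∞ := by
  simp only [eLpNorm_wordProd h₁ h₂ hr]
  rw [ENNReal.tsum_geometric, Ne, ENNReal.inv_eq_top, tsub_eq_zero_iff_le, not_le]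
  refine ENNReal.rpow_lt_one ?_ (by positivity)
  rw [← ENNReal.ofReal_one]
  exact (ENNReal.ofReal_lt_ofReal_iff one_pos).2 h

lemma ae_summable_wordProd {l₁ l₂ : ℝ} (h₁ : 0 < l₁) (h₂ : 0 < l₂) {r : ℕ} (hr : r ≠ 0)
    (h : (l₁ ^ r + l₂ ^ r) / 2 < 1) :
    ∀ᵐ ω ∂bernoulliMeasure, Summable fun m => wordProd l₁ l₂ m ω := by
  have := summable_norm_of_tsum_eLpNorm_ne_top (p := r) (by exact_mod_cast Nat.pos_of_ne_zero hr)
    (fun m => (measurable_wordProd l₁ l₂ m).aestronglyMeasurable)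
    (tsum_eLpNorm_wordProd_ne_top h₁ h₂ hr h)
  exact this.mono fun ω hω => hω.of_norm

/-- The norms form a convergent geometric series, so the sum exists in the complete space L^r;
almost everywhere it is the pointwise sum. -/
lemma memLp_tsum_wordProd {l₁ l₂ : ℝ} (h₁ : 0 < l₁) (h₂ : 0 < l₂) {r : ℕ} (hr : r ≠ 0)
    (h : (l₁ ^ r + l₂ ^ r) / 2 < 1) :
    MemLp (fun ω => ∑' m, wordProd l₁ l₂ m ω) r bernoulliMeasure := by
  have hq := tsum_eLpNorm_wordProd_ne_top h₁ h₂ hr h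
  have hmem : ∀ m, MemLp (wordProd l₁ l₂ m) r bernoulliMeasure := fun m =>
    ⟨(measurable_wordProd l₁ l₂ m).aestronglyMeasurable,
      lt_of_le_of_lt (ENNReal.le_tsum m) hq.lt_top⟩
  have : Fact ((1 : ℝ≥0∞) ≤ r) := ⟨by exact_mod_cast Nat.pos_of_ne_zero hr⟩
  have hs : ∑' m, ‖(hmem m).toLp‖ₑ ≠ ∞ := by simpa only [Lp.enorm_toLp] using hq
  refine (Lp.memLp (∑' m, (hmem m).toLp)).ae_eq ?_
  filter_upwards [Lp.coeFn_tsum hs, ae_all_iff.2 fun m => (hmem m).coeFn_toLp] with ω h1 h2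
  rw [h1]
  exact tsum_congr h2

/-! ### The stationary measure as the law of the coding map. -/

/-- The partial sums of the series defining the coding map. -/
noncomputable def partialX (l₁ l₂ d₁ d₂ : ℝ) (n : ℕ) (ω : ℕ → Fin 2) : ℝ :=
  ∑ m ∈ Finset.range n, wordProd l₁ l₂ m ω * (![d₁, d₂] : Fin 2 → ℝ) (ω m)

lemma measurable_partialX (l₁ l₂ d₁ d₂ : ℝ) (n : ℕ) : Measurable (partialX l₁ l₂ d₁ d₂ n) :=
  Finset.measurable_sum _ fun _ _ => (measurable_wordProd _ _ _).mul (measurable_letter _ _ _)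

lemma partialX_wordCons (l₁ l₂ d₁ d₂ : ℝ) (n : ℕ) (i : Fin 2) (ω : ℕ → Fin 2) :
    partialX l₁ l₂ d₁ d₂ (n + 1) (wordCons i ω) =
      (![l₁, l₂] : Fin 2 → ℝ) i * partialX l₁ l₂ d₁ d₂ n ω + (![d₁, d₂] : Fin 2 → ℝ) i := by
  rw [partialX, Finset.sum_range_succ', partialX, Finset.mul_sum]
  simp [wordProd_wordCons, wordProd_zero, mul_assoc]

lemma IsStationaryMeasure.lintegral_eq {l₁ l₂ d₁ d₂ : ℝ} {μ : Measure ℝ}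
    (h : IsStationaryMeasure l₁ l₂ d₁ d₂ μ) {f : ℝ → ℝ≥0∞} (hf : Measurable f) :
    ∫⁻ y, f y ∂μ = 2⁻¹ * ∫⁻ y, f (l₁ * y + d₁) ∂μ + 2⁻¹ * ∫⁻ y, f (l₂ * y + d₂) ∂μ := by
  conv_lhs => rw [h.2]
  rw [lintegral_add_measure, lintegral_smul_measure, lintegral_smul_measure,
    lintegral_map hf (by fun_prop), lintegral_map hf (by fun_prop)]
  rfl

/-- The integrand is f ∘ f_{i₁} ∘ ⋯ ∘ f_{i_n}. The induction hypothesis is applied to f ∘ f₁ and f ∘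
f₂, so the new letter is the outermost map, matching `wordCons`. -/
lemma IsStationaryMeasure.lintegral_eq_iterate {l₁ l₂ d₁ d₂ : ℝ} {μ : Measure ℝ}
    (h : IsStationaryMeasure l₁ l₂ d₁ d₂ μ) (n : ℕ) {f : ℝ → ℝ≥0∞} (hf : Measurable f) :
    ∫⁻ y, f y ∂μ = ∫⁻ y, ∫⁻ ω, f (wordProd l₁ l₂ n ω * y + partialX l₁ l₂ d₁ d₂ n ω)
      ∂bernoulliMeasure ∂μ := by
  have := h.1
  induction n generalizing f with
  | zero => simp [wordProd_zero, partialX]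
  | succ n ih =>
    have hm : ∀ {g : ℝ → ℝ≥0∞}, Measurable g → ∀ k, Measurable fun p : ℝ × (ℕ → Fin 2) =>
        g (wordProd l₁ l₂ k p.2 * p.1 + partialX l₁ l₂ d₁ d₂ k p.2) := fun hg k =>
      hg.comp ((((measurable_wordProd l₁ l₂ k).comp measurable_snd).mul measurable_fst).add
        ((measurable_partialX l₁ l₂ d₁ d₂ k).comp measurable_snd))
    have h₁ : Measurable fun y => f (l₁ * y + d₁) := hf.comp (by fun_prop)
    have h₂ : Measurable fun y => f (l₂ * y + d₂) := hf.comp (by fun_prop)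
    rw [h.lintegral_eq hf, ih h₁, ih h₂,
      ← lintegral_const_mul _ (hm h₁ n).lintegral_prod_right',
      ← lintegral_const_mul _ (hm h₂ n).lintegral_prod_right',
      ← lintegral_add_left ((hm h₁ n).lintegral_prod_right'.const_mul _)]
    refine lintegral_congr fun y => ?_
    rw [lintegral_bernoulliMeasure
      (F := fun ω => f (wordProd l₁ l₂ (n + 1) ω * y + partialX l₁ l₂ d₁ d₂ (n + 1) ω))
      ((hm hf (n + 1)).comp measurable_prodMk_left)]
    simp only [wordProd_wordCons, partialX_wordCons, Matrix.cons_val_zero, Matrix.cons_val_one]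
    congr! 5 <;> ring

lemma IsStationaryMeasure.eq_map_iterate {l₁ l₂ d₁ d₂ : ℝ} {μ : Measure ℝ}
    (h : IsStationaryMeasure l₁ l₂ d₁ d₂ μ) (n : ℕ) :
    μ = (μ.prod bernoulliMeasure).map
      (fun p => wordProd l₁ l₂ n p.2 * p.1 + partialX l₁ l₂ d₁ d₂ n p.2) := by
  have := h.1
  have hm : Measurable fun p : ℝ × (ℕ → Fin 2) =>
      wordProd l₁ l₂ n p.2 * p.1 + partialX l₁ l₂ d₁ d₂ n p.2 :=
    (((measurable_wordProd l₁ l₂ n).comp measurable_snd).mul measurable_fst).add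
      ((measurable_partialX l₁ l₂ d₁ d₂ n).comp measurable_snd)
  refine Measure.ext_of_lintegral _ fun f hf => ?_
  rw [lintegral_map hf hm, lintegral_prod (fun p : ℝ × (ℕ → Fin 2) =>
    f (wordProd l₁ l₂ n p.2 * p.1 + partialX l₁ l₂ d₁ d₂ n p.2)) (hf.comp hm).aemeasurable]
  exact h.lintegral_eq_iterate n hf

lemma norm_letter_le (d₁ d₂ : ℝ) (i : Fin 2) :
    ‖(![d₁, d₂] : Fin 2 → ℝ) i‖ ≤ |d₁| + |d₂| := by
  fin_cases i <;> simp

lemma summable_codingX {l₁ l₂ : ℝ} (h₁ : 0 < l₁) (h₂ : 0 < l₂) (d₁ d₂ : ℝ) {ω : ℕ → Fin 2}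
    (h : Summable fun m => wordProd l₁ l₂ m ω) :
    Summable fun m => wordProd l₁ l₂ m ω * (![d₁, d₂] : Fin 2 → ℝ) (ω m) := by
  refine Summable.of_norm_bounded (h.mul_right (|d₁| + |d₂|)) fun m => ?_
  rw [norm_mul, Real.norm_of_nonneg (wordProd_pos h₁ h₂ m ω).le]
  exact mul_le_mul_of_nonneg_left (norm_letter_le _ _ _) (wordProd_pos h₁ h₂ m ω).le

lemma measurable_codingX (l₁ l₂ d₁ d₂ : ℝ) : Measurable (codingX l₁ l₂ d₁ d₂) := by
  unfold codingX
  exact Measurable.tsum fun m => (measurable_wordProd _ _ _).mul (measurable_letter _ _ _)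

lemma codingX_wordCons {l₁ l₂ d₁ d₂ : ℝ} (h₁ : 0 < l₁) (h₂ : 0 < l₂) (i : Fin 2)
    {ω : ℕ → Fin 2} (h : Summable fun m => wordProd l₁ l₂ m ω) :
    codingX l₁ l₂ d₁ d₂ (wordCons i ω) =
      (![l₁, l₂] : Fin 2 → ℝ) i * codingX l₁ l₂ d₁ d₂ ω + (![d₁, d₂] : Fin 2 → ℝ) i := by
  have hs := (summable_codingX h₁ h₂ d₁ d₂ h).hasSum.mul_left ((![l₁, l₂] : Fin 2 → ℝ) i)
  have h0 : HasSum (fun m => wordProd l₁ l₂ (m + 1) (wordCons i ω) *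
      (![d₁, d₂] : Fin 2 → ℝ) (wordCons i ω (m + 1)))
      ((![l₁, l₂] : Fin 2 → ℝ) i * codingX l₁ l₂ d₁ d₂ ω) := by
    simpa only [wordProd_wordCons, wordCons_succ, mul_assoc, codingX] using hs
  have h1 := (hasSum_nat_add_iff (f := fun m => wordProd l₁ l₂ m (wordCons i ω) *
    (![d₁, d₂] : Fin 2 → ℝ) (wordCons i ω m)) 1).1 h0
  simpa [wordProd_zero, codingX] using h1.tsum_eq

lemma isStationaryMeasure_map_codingX {l₁ l₂ : ℝ} (h₁ : 0 < l₁) (h₂ : 0 < l₂) (d₁ d₂ : ℝ)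
    (h : ∀ᵐ ω ∂bernoulliMeasure, Summable fun m => wordProd l₁ l₂ m ω) :
    IsStationaryMeasure l₁ l₂ d₁ d₂ (bernoulliMeasure.map (codingX l₁ l₂ d₁ d₂)) := by
  have hX := measurable_codingX l₁ l₂ d₁ d₂
  refine ⟨Measure.isProbabilityMeasure_map hX.aemeasurable, ?_⟩
  refine Measure.ext_of_lintegral _ fun f hf => ?_
  have hf₁ : Measurable fun y => f (l₁ * y + d₁) := hf.comp (by fun_prop)
  have hf₂ : Measurable fun y => f (l₂ * y + d₂) := hf.comp (by fun_prop)
  rw [lintegral_add_measure, lintegral_smul_measure, lintegral_smul_measure,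
    lintegral_map hf hX, lintegral_map hf (by fun_prop), lintegral_map hf (by fun_prop),
    lintegral_map hf₁ hX, lintegral_map hf₂ hX, lintegral_bernoulliMeasure (F := fun ω => f (codingX l₁ l₂ d₁ d₂ ω)) (hf.comp hX)]
  simp only [smul_eq_mul]
  congr 2 <;> refine lintegral_congr_ae (h.mono fun ω hω => ?_)
  · simpa using congrArg f (codingX_wordCons (d₁ := d₁) (d₂ := d₂) h₁ h₂ 0 hω)
  · simpa using congrArg f (codingX_wordCons (d₁ := d₁) (d₂ := d₂) h₁ h₂ 1 hω)

/-- Under `μ.prod bernoulliMeasure` the n-fold image of the starting point y always has law μ, yet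
converges almost surely to X(ω): the product multiplying y is the general term of a convergent
series. No moment of μ is needed, as the test functions are bounded. -/
lemma IsStationaryMeasure.eq_map_codingX {l₁ l₂ d₁ d₂ : ℝ} {μ : Measure ℝ}
    (hμ : IsStationaryMeasure l₁ l₂ d₁ d₂ μ) (h₁ : 0 < l₁) (h₂ : 0 < l₂)
    (h : ∀ᵐ ω ∂bernoulliMeasure, Summable fun m => wordProd l₁ l₂ m ω) :
    μ = bernoulliMeasure.map (codingX l₁ l₂ d₁ d₂) := by
  have := hμ.1
  have hX := measurable_codingX l₁ l₂ d₁ d₂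
  have : IsProbabilityMeasure (bernoulliMeasure.map (codingX l₁ l₂ d₁ d₂)) :=
    Measure.isProbabilityMeasure_map hX.aemeasurable
  refine ext_of_forall_integral_eq_of_IsFiniteMeasure fun g => ?_
  have hm : ∀ n, Measurable fun p : ℝ × (ℕ → Fin 2) =>
      wordProd l₁ l₂ n p.2 * p.1 + partialX l₁ l₂ d₁ d₂ n p.2 := fun n =>
    (((measurable_wordProd l₁ l₂ n).comp measurable_snd).mul measurable_fst).add
      ((measurable_partialX l₁ l₂ d₁ d₂ n).comp measurable_snd)
  have hlim : Tendsto (fun n => ∫ p, g (wordProd l₁ l₂ n p.2 * p.1 + partialX l₁ l₂ d₁ d₂ n p.2)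
      ∂(μ.prod bernoulliMeasure)) atTop
      (𝓝 (∫ p, g (codingX l₁ l₂ d₁ d₂ p.2) ∂(μ.prod bernoulliMeasure))) := by
    refine tendsto_integral_of_dominated_convergence (fun _ => ‖g‖)
      (fun n => (g.continuous.measurable.comp (hm n)).aestronglyMeasurable)
      (integrable_const _) (fun n => ae_of_all _ fun p => g.norm_coe_le_norm _) ?_
    filter_upwards [Measure.quasiMeasurePreserving_snd.ae h] with p hp
    have h0 := hp.tendsto_atTop_zero.mul_const p.1
    have h1 := (summable_codingX h₁ h₂ d₁ d₂ hp).hasSum.tendsto_sum_nat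
    have h2 := h0.add h1
    rw [zero_mul, zero_add] at h2
    exact (g.continuous.tendsto _).comp h2
  have hconst : ∀ n, ∫ p, g (wordProd l₁ l₂ n p.2 * p.1 + partialX l₁ l₂ d₁ d₂ n p.2)
      ∂(μ.prod bernoulliMeasure) = ∫ x, g x ∂μ := fun n => by
    conv_rhs => rw [hμ.eq_map_iterate n]
    rw [integral_map (hm n).aemeasurable g.continuous.aestronglyMeasurable]
  simp only [hconst] at hlim
  rw [tendsto_nhds_unique tendsto_const_nhds hlim,
    integral_map hX.aemeasurable g.continuous.aestronglyMeasurable,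
    integral_fun_snd (fun ω => g (codingX l₁ l₂ d₁ d₂ ω))]
  simp

lemma stationaryMeasure_eq_map_codingX {l₁ l₂ : ℝ} (h₁ : 0 < l₁) (h₂ : 0 < l₂) (d₁ d₂ : ℝ)
    (h : ∀ᵐ ω ∂bernoulliMeasure, Summable fun m => wordProd l₁ l₂ m ω) :
    stationaryMeasure l₁ l₂ d₁ d₂ = bernoulliMeasure.map (codingX l₁ l₂ d₁ d₂) := by
  have hex : ∃ μ : Measure ℝ, IsStationaryMeasure l₁ l₂ d₁ d₂ μ :=
    ⟨_, isStationaryMeasure_map_codingX h₁ h₂ d₁ d₂ h⟩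
  rw [stationaryMeasure, dif_pos hex]
  exact hex.choose_spec.eq_map_codingX h₁ h₂ h

lemma existsUnique_isStationaryMeasure {l₁ l₂ : ℝ} (h₁ : 0 < l₁) (h₂ : 0 < l₂) (d₁ d₂ : ℝ)
    (h : ∀ᵐ ω ∂bernoulliMeasure, Summable fun m => wordProd l₁ l₂ m ω) :
    ∃! μ : Measure ℝ, IsStationaryMeasure l₁ l₂ d₁ d₂ μ :=
  ⟨_, isStationaryMeasure_map_codingX h₁ h₂ d₁ d₂ h, fun _ hμ => hμ.eq_map_codingX h₁ h₂ h⟩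

/-! ### Differentiating the coding map in the parameter. -/

/-- The number of occurrences of the second letter among the first `m` letters of `ω`. -/
def countSecond (m : ℕ) (ω : ℕ → Fin 2) : ℕ :=
  ((Finset.range m).filter (fun s => ¬ω s = 0)).card

lemma wordProd_eq_pow (l₁ l₂ : ℝ) (m : ℕ) (ω : ℕ → Fin 2) :
    wordProd l₁ l₂ m ω = l₁ ^ countFirst m ω * l₂ ^ countSecond m ω := by
  have h : ∀ i : Fin 2, (![l₁, l₂] : Fin 2 → ℝ) i = if i = 0 then l₁ else l₂ := by
    intro i
    fin_cases i <;> simp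
  simp only [wordProd, h, Finset.prod_ite, Finset.prod_const, countFirst, countSecond]

lemma measurable_countFirst (m : ℕ) : Measurable (countFirst m) := by
  unfold countFirst
  simp only [Finset.card_filter]
  exact Finset.measurable_sum _ fun s _ =>
    (measurable_of_finite (fun i : Fin 2 => if i = 0 then 1 else 0)).comp (measurable_pi_apply s)

lemma measurable_countSecond (m : ℕ) : Measurable (countSecond m) := by
  unfold countSecond
  simp only [Finset.card_filter]
  exact Finset.measurable_sum _ fun s _ =>
    (measurable_of_finite (fun i : Fin 2 => if ¬i = 0 then 1 else 0)).comp (measurable_pi_apply s)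

/-- The `j`-th derivative in `l₁` of the `m`-th term of the series defining the coding map. -/
noncomputable def derivTerm (l₁ l₂ d₁ d₂ : ℝ) (j m : ℕ) (ω : ℕ → Fin 2) : ℝ :=
  ((countFirst m ω).descFactorial j : ℝ) * l₁ ^ (countFirst m ω - j) *
    (l₂ ^ countSecond m ω * (![d₁, d₂] : Fin 2 → ℝ) (ω m))

/-- The `j`-th derivative in `l₁` of the coding map, as a series. -/
noncomputable def derivX (l₁ l₂ d₁ d₂ : ℝ) (j : ℕ) (ω : ℕ → Fin 2) : ℝ :=
  ∑' m, derivTerm l₁ l₂ d₁ d₂ j m ω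

lemma derivTerm_zero (l₁ l₂ d₁ d₂ : ℝ) (m : ℕ) (ω : ℕ → Fin 2) :
    derivTerm l₁ l₂ d₁ d₂ 0 m ω = wordProd l₁ l₂ m ω * (![d₁, d₂] : Fin 2 → ℝ) (ω m) := by
  rw [derivTerm, wordProd_eq_pow]
  simp [mul_assoc]

lemma derivX_zero (l₁ l₂ d₁ d₂ : ℝ) (ω : ℕ → Fin 2) :
    derivX l₁ l₂ d₁ d₂ 0 ω = codingX l₁ l₂ d₁ d₂ ω := by
  simp only [derivX, derivTerm_zero, codingX]

lemma measurable_derivX (l₁ l₂ d₁ d₂ : ℝ) (j : ℕ) : Measurable (derivX l₁ l₂ d₁ d₂ j) := by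
  unfold derivX derivTerm
  refine Measurable.tsum fun m => ?_
  have h1 : Measurable fun o : ℕ => (o.descFactorial j : ℝ) * l₁ ^ (o - j) := measurable_from_nat
  have h2 : Measurable fun o : ℕ => l₂ ^ o := measurable_from_nat
  exact (h1.comp (measurable_countFirst m)).mul
    ((h2.comp (measurable_countSecond m)).mul (measurable_letter d₁ d₂ m))

lemma hasDerivAt_derivTerm (l₂ d₁ d₂ t : ℝ) (j m : ℕ) (ω : ℕ → Fin 2) :
    HasDerivAt (fun s => derivTerm s l₂ d₁ d₂ j m ω) (derivTerm t l₂ d₁ d₂ (j + 1) m ω) t := by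
  unfold derivTerm
  refine HasDerivAt.mul_const ?_ _
  refine ((hasDerivAt_pow (countFirst m ω - j) t).const_mul _).congr_deriv ?_
  rw [Nat.descFactorial_succ, Nat.sub_sub]
  push_cast
  ring

/-- The falling factorial is at most o^j, and o^j (a/b)^o is bounded. -/
lemma exists_descFactorial_mul_pow_le {a b : ℝ} (ha : 0 < a) (hab : a < b) (j : ℕ) :
    ∃ C : ℝ, 0 ≤ C ∧ ∀ o : ℕ, (o.descFactorial j : ℝ) * a ^ (o - j) ≤ C * b ^ o := by
  have hb : 0 < b := ha.trans hab
  have hq : |a / b| < 1 := by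
    rw [abs_of_pos (by positivity), div_lt_one hb]
    exact hab
  obtain ⟨B, hB⟩ := (tendsto_pow_const_mul_const_pow_of_abs_lt_one j hq).bddAbove_range
  have hB' : ∀ o : ℕ, (o : ℝ) ^ j * (a / b) ^ o ≤ B := fun o => hB ⟨o, rfl⟩
  have hB0 : 0 ≤ B := le_trans (by positivity) (hB' 0)
  refine ⟨B / a ^ j, by positivity, fun o => ?_⟩
  -- Here the truncated exponent `o - j` is 0, but the falling factorial vanishes.
  by_cases hj : o < j
  · rw [Nat.descFactorial_eq_zero_iff_lt.2 hj]
    simp only [Nat.cast_zero, zero_mul]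
    positivity
  · have h1 : a ^ (o - j) = a ^ o / a ^ j := by
      rw [eq_div_iff (by positivity), ← pow_add, Nat.sub_add_cancel (not_lt.1 hj)]
    have h2 : ((o.descFactorial j : ℕ) : ℝ) ≤ (o : ℝ) ^ j := by
      exact_mod_cast Nat.descFactorial_le_pow o j
    have h3 : a ^ o = (a / b) ^ o * b ^ o := by
      rw [← mul_pow, div_mul_cancel₀ _ hb.ne']
    calc (o.descFactorial j : ℝ) * a ^ (o - j) ≤ (o : ℝ) ^ j * a ^ (o - j) := by gcongr
      _ = ((o : ℝ) ^ j * (a / b) ^ o) * (b ^ o / a ^ j) := by rw [h1, h3]; ring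
      _ ≤ B * (b ^ o / a ^ j) := by gcongr; exact hB' o
      _ = B / a ^ j * b ^ o := by ring

lemma exists_norm_derivTerm_le {a b l₂ : ℝ} (ha : 0 < a) (hab : a < b) (hl₂ : 0 < l₂)
    (d₁ d₂ : ℝ) (j : ℕ) :
    ∃ C : ℝ, 0 ≤ C ∧ ∀ t ∈ Set.Ioo 0 a, ∀ m ω,
      ‖derivTerm t l₂ d₁ d₂ j m ω‖ ≤ C * wordProd b l₂ m ω := by
  obtain ⟨C, hC, h⟩ := exists_descFactorial_mul_pow_le ha hab j
  refine ⟨C * (|d₁| + |d₂|), by positivity, fun t ht m ω => ?_⟩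
  have ht0 : 0 ≤ t := ht.1.le
  rw [derivTerm, norm_mul, norm_mul (l₂ ^ _), Real.norm_of_nonneg (by positivity),
    Real.norm_of_nonneg (by positivity : (0 : ℝ) ≤ l₂ ^ countSecond m ω), wordProd_eq_pow]
  have h1 : ((countFirst m ω).descFactorial j : ℝ) * t ^ (countFirst m ω - j) ≤
      C * b ^ countFirst m ω :=
    le_trans (by gcongr; exact ht.2.le) (h _)
  have hb : 0 < b := ha.trans hab
  calc _ ≤ (C * b ^ countFirst m ω) * (l₂ ^ countSecond m ω * (|d₁| + |d₂|)) :=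
        mul_le_mul h1 (by gcongr; exact norm_letter_le _ _ _) (by positivity) (by positivity)
    _ = _ := by ring

lemma wordProd_le_wordProd {t b l₂ : ℝ} (ht : 0 < t) (htb : t ≤ b) (hl₂ : 0 < l₂) (m : ℕ)
    (ω : ℕ → Fin 2) : wordProd t l₂ m ω ≤ wordProd b l₂ m ω := by
  rw [wordProd_eq_pow, wordProd_eq_pow]
  gcongr

lemma summable_wordProd_of_le {t b l₂ : ℝ} (ht : 0 < t) (htb : t ≤ b) (hl₂ : 0 < l₂)
    {ω : ℕ → Fin 2} (h : Summable fun m => wordProd b l₂ m ω) :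
    Summable fun m => wordProd t l₂ m ω :=
  Summable.of_nonneg_of_le (fun m => (wordProd_pos ht hl₂ m ω).le)
    (fun m => wordProd_le_wordProd ht htb hl₂ m ω) h

section Path

variable {a b l₂ : ℝ} {ω : ℕ → Fin 2}

lemma summable_derivTerm (ha : 0 < a) (hab : a < b) (hl₂ : 0 < l₂) (d₁ d₂ : ℝ)
    (h : Summable fun m => wordProd b l₂ m ω) (j : ℕ) {t : ℝ} (ht : t ∈ Set.Ioo 0 a) :
    Summable fun m => derivTerm t l₂ d₁ d₂ j m ω := by
  obtain ⟨C, _, hC⟩ := exists_norm_derivTerm_le ha hab hl₂ d₁ d₂ j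
  exact Summable.of_norm_bounded (h.mul_left C) fun m => hC t ht m ω

lemma hasDerivAt_derivX (ha : 0 < a) (hab : a < b) (hl₂ : 0 < l₂) (d₁ d₂ : ℝ)
    (h : Summable fun m => wordProd b l₂ m ω) (j : ℕ) {t : ℝ} (ht : t ∈ Set.Ioo 0 a) :
    HasDerivAt (fun s => derivX s l₂ d₁ d₂ j ω) (derivX t l₂ d₁ d₂ (j + 1) ω) t := by
  obtain ⟨C, _, hC⟩ := exists_norm_derivTerm_le ha hab hl₂ d₁ d₂ (j + 1)
  exact hasDerivAt_tsum_of_isPreconnected (h.mul_left C) isOpen_Ioo isPreconnected_Ioo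
    (fun m s _ => hasDerivAt_derivTerm l₂ d₁ d₂ s j m ω) (fun m s hs => hC s hs m ω) ht
    (summable_derivTerm ha hab hl₂ d₁ d₂ h j ht) ht

lemma exists_norm_derivX_le (ha : 0 < a) (hab : a < b) (hl₂ : 0 < l₂) (d₁ d₂ : ℝ) (j : ℕ) :
    ∃ C : ℝ, 0 ≤ C ∧ ∀ t ∈ Set.Ioo 0 a, ∀ ω : ℕ → Fin 2,
      (Summable fun m => wordProd b l₂ m ω) →
      |derivX t l₂ d₁ d₂ j ω| ≤ C * ∑' m, wordProd b l₂ m ω := by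
  obtain ⟨C, hC0, hC⟩ := exists_norm_derivTerm_le ha hab hl₂ d₁ d₂ j
  refine ⟨C, hC0, fun t ht ω h => ?_⟩
  rw [← tsum_mul_left, ← Real.norm_eq_abs]
  exact tsum_of_norm_bounded (h.mul_left C).hasSum fun m => hC t ht m ω

lemma derivTerm_eq_formalTerm {t : ℝ} (ht : t ≠ 0) (l₂ d₁ d₂ : ℝ) (j m : ℕ) :
    derivTerm t l₂ d₁ d₂ j m ω = (j ! : ℝ) / t ^ j * formalTerm t l₂ d₁ d₂ j m ω := by
  rw [derivTerm, formalTerm, wordProd_eq_pow, Nat.descFactorial_eq_factorial_mul_choose]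
  push_cast
  by_cases hj : countFirst m ω < j
  · simp [Nat.choose_eq_zero_of_lt hj]
  · have h1 : t ^ countFirst m ω = t ^ (countFirst m ω - j) * t ^ j := by
      rw [← pow_add, Nat.sub_add_cancel (not_lt.1 hj)]
    rw [h1]
    field_simp

lemma summable_formalTerm (ha : 0 < a) (hab : a < b) (hl₂ : 0 < l₂) (d₁ d₂ : ℝ)
    (h : Summable fun m => wordProd b l₂ m ω) (j : ℕ) {t : ℝ} (ht : t ∈ Set.Ioo 0 a) :
    Summable fun m => formalTerm t l₂ d₁ d₂ j m ω := by
  have h1 := summable_derivTerm ha hab hl₂ d₁ d₂ h j ht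
  simp only [derivTerm_eq_formalTerm ht.1.ne'] at h1
  refine (summable_mul_left_iff ?_).1 h1
  have := pow_ne_zero j ht.1.ne'
  positivity

lemma derivX_eq_formalX (ha : 0 < a) (hab : a < b) (hl₂ : 0 < l₂) (d₁ d₂ : ℝ)
    (h : Summable fun m => wordProd b l₂ m ω) {j : ℕ} (hj : 1 ≤ j) {t : ℝ}
    (ht : t ∈ Set.Ioo 0 a) :
    derivX t l₂ d₁ d₂ j ω = formalX t l₂ d₁ d₂ j ω := by
  rw [derivX, (summable_derivTerm ha hab hl₂ d₁ d₂ h j ht).tsum_eq_zero_add, formalX,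
    ← tsum_mul_left]
  -- The empty prefix contains no first letter and j ≥ 1, so the sum may start at m = 1 as in
  -- `formalX`.
  have h0 : derivTerm t l₂ d₁ d₂ j 0 ω = 0 := by
    simp [derivTerm, countFirst, Nat.descFactorial_eq_zero_iff_lt.2 hj]
  rw [h0, zero_add]
  exact tsum_congr fun m => derivTerm_eq_formalTerm ht.1.ne' l₂ d₁ d₂ j (m + 1)

end Path

/-! ### Iterated derivatives from a chain of first derivatives; growth of φ. -/

lemma eqOn_iteratedDeriv_of_hasDerivAt {s : Set ℝ} (hs : IsOpen s) {r : ℕ} {G : ℕ → ℝ → ℝ}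
    (hG : ∀ n < r, ∀ x ∈ s, HasDerivAt (G n) (G (n + 1) x) x) {g : ℝ → ℝ}
    (hg : Set.EqOn g (G 0) s) : ∀ n ≤ r, Set.EqOn (iteratedDeriv n g) (G n) s := by
  intro n
  induction n with
  | zero => simpa [iteratedDeriv_zero] using hg
  | succ n ih =>
    intro hn x hx
    have h1 : iteratedDeriv n g =ᶠ[𝓝 x] G n :=
      Filter.eventuallyEq_of_mem (hs.mem_nhds hx) (ih (by omega))
    rw [iteratedDeriv_succ, h1.deriv_eq, (hG n (by omega) x hx).deriv]

lemma differentiableUpToAt_of_hasDerivAt {s : Set ℝ} (hs : IsOpen s) {r : ℕ} {G : ℕ → ℝ → ℝ}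
    (hG : ∀ n < r, ∀ x ∈ s, HasDerivAt (G n) (G (n + 1) x) x) {g : ℝ → ℝ}
    (hg : Set.EqOn g (G 0) s) {x₀ : ℝ} (hx₀ : x₀ ∈ s) : DifferentiableUpToAt r g x₀ := by
  intro n hn
  have h : ∀ x ∈ s, DifferentiableAt ℝ (iteratedDeriv n g) x := fun x hx =>
    ((hG n hn x hx).congr_of_eventuallyEq (Filter.eventuallyEq_of_mem (hs.mem_nhds hx)
      (eqOn_iteratedDeriv_of_hasDerivAt hs hG hg n hn.le))).differentiableAt
  exact ⟨h x₀ hx₀, fun _ => Filter.eventually_of_mem (hs.mem_nhds hx₀) h⟩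

lemma abs_le_of_abs_deriv_le {f : ℝ → ℝ} (hf : Differentiable ℝ f) {K : ℝ} (hK : 0 ≤ K) {p : ℕ}
    (h : ∀ x, |deriv f x| ≤ K * (1 + |x|) ^ p) (x : ℝ) :
    |f x| ≤ (|f 0| + K) * (1 + |x|) ^ (p + 1) := by
  have h1 : ‖f x - f 0‖ ≤ K * (1 + |x|) ^ p * ‖x - 0‖ := by
    refine (convex_closedBall (0 : ℝ) |x|).norm_image_sub_le_of_norm_deriv_le (𝕜 := ℝ)
      (fun y _ => hf y) (fun y hy => (h y).trans ?_) ?_ ?_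
    · rw [mem_closedBall_zero_iff, Real.norm_eq_abs] at hy
      gcongr
    · simp
    · simp
  rw [sub_zero, Real.norm_eq_abs, Real.norm_eq_abs] at h1
  have h2 : |f x| ≤ |f 0| + |f x - f 0| := by
    have := abs_add_le (f 0) (f x - f 0)
    rwa [add_sub_cancel] at this
  have h3 : (1 : ℝ) ≤ (1 + |x|) ^ (p + 1) := one_le_pow₀ (by linarith [abs_nonneg x])
  have h4 : K * (1 + |x|) ^ p * |x| ≤ K * (1 + |x|) ^ (p + 1) := by
    rw [pow_succ, ← mul_assoc]
    gcongr
    linarith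
  have h5 := mul_le_mul_of_nonneg_left h3 (abs_nonneg (f 0))
  linarith

/-- Descending from order r, each application of the mean value inequality adds one to the exponent.
-/
lemma exists_abs_iteratedDeriv_le {r : ℕ} {phi : ℝ → ℝ} (hphi : ContDiff ℝ (r : ℕ∞) phi)
    (hb : ∃ M : ℝ, ∀ x, |iteratedDeriv r phi x| ≤ M) :
    ∃ K : ℝ, 0 ≤ K ∧ ∀ k ≤ r, ∀ x, |iteratedDeriv k phi x| ≤ K * (1 + |x|) ^ (r - k) := by
  have key : ∀ p ≤ r, ∃ K : ℝ, 0 ≤ K ∧ ∀ x, |iteratedDeriv (r - p) phi x| ≤ K * (1 + |x|) ^ p := by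
    intro p
    induction p with
    | zero =>
      intro _
      obtain ⟨M, hM⟩ := hb
      exact ⟨M, (abs_nonneg _).trans (hM 0), by simpa using hM⟩
    | succ p ih =>
      intro hp
      obtain ⟨K, hK, h⟩ := ih (by omega)
      refine ⟨|iteratedDeriv (r - (p + 1)) phi 0| + K, by positivity,
        abs_le_of_abs_deriv_le ?_ hK fun x => ?_⟩
      · refine hphi.differentiable_iteratedDeriv _ ?_
        exact WithTop.coe_lt_coe.2 (Nat.cast_lt.2 (by omega : r - (p + 1) < r))
      · rw [← iteratedDeriv_succ, show r - (p + 1) + 1 = r - p by omega]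
        exact h x
  choose! K hK h using key
  refine ⟨∑ p ∈ Finset.range (r + 1), K p,
    Finset.sum_nonneg fun p hp => hK p (by rw [Finset.mem_range] at hp; omega), fun k hk x => ?_⟩
  have h1 := h (r - k) (by omega) x
  rw [Nat.sub_sub_self hk] at h1
  refine h1.trans ?_
  gcongr
  exact Finset.single_le_sum (f := K)
    (fun p hp => hK p (by rw [Finset.mem_range] at hp; omega))
    (Finset.mem_range.2 (by omega))

/-! ### The formula of Faà di Bruno. -/

/-- The multi-indices `k : Fin n → ℕ` of weight `∑ (j + 1) k_j = l`. -/
def weightSet (n l : ℕ) : Finset (Fin n → ℕ) :=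
  (Fintype.piFinset (fun _ : Fin n => Finset.range (l + 1))).filter
    (fun k => ∑ j : Fin n, ((j : ℕ) + 1) * k j = l)

lemma mem_weightSet {n l : ℕ} {k : Fin n → ℕ} :
    k ∈ weightSet n l ↔ ∑ j : Fin n, ((j : ℕ) + 1) * k j = l := by
  rw [weightSet, Finset.mem_filter, and_iff_right_iff_imp, Fintype.mem_piFinset]
  rintro h j
  have h1 : ((j : ℕ) + 1) * k j ≤ l :=
    h ▸ Finset.single_le_sum (f := fun j : Fin n => ((j : ℕ) + 1) * k j)
      (fun _ _ => Nat.zero_le _) (Finset.mem_univ j)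
  have h2 : k j ≤ ((j : ℕ) + 1) * k j := Nat.le_mul_of_pos_left _ (Nat.succ_pos _)
  exact Finset.mem_range.2 (by omega)

lemma sum_le_of_mem_weightSet {n l : ℕ} {k : Fin n → ℕ} (hk : k ∈ weightSet n l) :
    ∑ j, k j ≤ l := by
  rw [← mem_weightSet.1 hk]
  exact Finset.sum_le_sum fun j _ => Nat.le_mul_of_pos_left _ (Nat.succ_pos _)

lemma mul_le_of_mem_weightSet {n l : ℕ} {k : Fin n → ℕ} (hk : k ∈ weightSet n l) (j : Fin n) :
    ((j : ℕ) + 1) * k j ≤ l := by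
  rw [← mem_weightSet.1 hk]
  exact Finset.single_le_sum (f := fun j : Fin n => ((j : ℕ) + 1) * k j)
      (fun _ _ => Nat.zero_le _) (Finset.mem_univ j)

/-- The reciprocal weight `∏ 1 / (k_j! (j + 1)!^{k_j})`. -/
noncomputable def invWeight {n : ℕ} (k : Fin n → ℕ) : ℝ :=
  ∏ j : Fin n, (((k j)! : ℝ) * (((j : ℕ) + 1)! : ℝ) ^ k j)⁻¹

lemma brunoCoeff_eq {l : ℕ} (k : Fin l → ℕ) : brunoCoeff l k = l ! * invWeight k := by
  rw [brunoCoeff, invWeight, Finset.prod_inv_distrib, div_eq_mul_inv]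

lemma prod_add_single {n : ℕ} (g : Fin n → ℕ → ℝ) (m : Fin n → ℕ) (i : Fin n) :
    ∏ j, g j ((m + Pi.single i 1 : Fin n → ℕ) j) = g i (m i + 1) * ∏ j ∈ Finset.univ.erase i, g j (m j) := by
  rw [← Finset.mul_prod_erase _ _ (Finset.mem_univ i)]
  congr 1
  · simp
  · refine Finset.prod_congr rfl fun j hj => ?_
    simp [Pi.single_eq_of_ne (Finset.ne_of_mem_erase hj)]

lemma invWeight_add_single {n : ℕ} (m : Fin n → ℕ) (i : Fin n) :
    ((m + Pi.single i 1 : Fin n → ℕ) i : ℝ) * invWeight (m + Pi.single i 1) =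
      invWeight m * (((i : ℕ) + 1)! : ℝ)⁻¹ := by
  unfold invWeight
  rw [prod_add_single (fun (j : Fin n) x => ((x ! : ℝ) * (((j : ℕ) + 1)! : ℝ) ^ x)⁻¹),
    ← Finset.mul_prod_erase _ _ (Finset.mem_univ i)]
  simp only [Pi.add_apply, Pi.single_eq_same, Nat.factorial_succ (m i), pow_succ]
  have h1 : ((m i : ℝ) + 1) ≠ 0 := by positivity
  have h2 : ((m i)! : ℝ) ≠ 0 := by positivity
  have h3 : (((i : ℕ) + 1)! : ℝ) ≠ 0 := by positivity
  push_cast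
  field_simp

lemma weight_add_single {n : ℕ} (m : Fin n → ℕ) (i : Fin n) :
    ∑ j : Fin n, ((j : ℕ) + 1) * (m + Pi.single i 1 : Fin n → ℕ) j =
      ∑ j : Fin n, ((j : ℕ) + 1) * m j + ((i : ℕ) + 1) := by
  simp [mul_add, Finset.sum_add_distrib, Pi.single_apply]

lemma exists_eq_add_single {n : ℕ} {k : Fin n → ℕ} {i : Fin n} (h : k i ≠ 0) :
    ∃ m : Fin n → ℕ, k = m + Pi.single i 1 := by
  refine ⟨k - Pi.single i 1, (tsub_add_cancel_of_le ?_).symm⟩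
  rw [Pi.le_def]
  intro j
  by_cases hj : j = i
  · subst hj
    rw [Pi.single_eq_same]
    omega
  · rw [Pi.single_eq_of_ne hj]
    exact Nat.zero_le _

/-- Reindexing by k = m + e_i: the indices missed have k_i = 0 and contribute nothing. -/
lemma sum_weightSet_mul {n : ℕ} (i : Fin n) (l : ℕ) (f : (Fin n → ℕ) → ℝ) :
    ∑ k ∈ weightSet n (l + (i + 1)), (k i : ℝ) * invWeight k * f k =
      ∑ m ∈ weightSet n l, invWeight m * (((i : ℕ) + 1)! : ℝ)⁻¹ * f (m + Pi.single i 1) := by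
  symm
  refine Finset.sum_of_injOn (fun m => m + Pi.single i 1) (fun a _ b _ h => by simpa using h)
    ?_ ?_ ?_
  · intro m hm
    have hm := mem_weightSet.1 (Finset.mem_coe.1 hm)
    exact Finset.mem_coe.2 (mem_weightSet.2 (by rw [weight_add_single, hm]))
  · intro k hk hk'
    have hk := mem_weightSet.1 hk
    by_cases h0 : k i = 0
    · simp [h0]
    · obtain ⟨m, rfl⟩ := exists_eq_add_single h0
      rw [weight_add_single] at hk
      exact absurd ⟨m, Finset.mem_coe.2 (mem_weightSet.2 (by omega)), rfl⟩ hk'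
  · intro m _
    rw [invWeight_add_single]

/-- Differentiating one factor x_i replaces e_i by e_{i+1}. Removing that unit reduces both sides to
one sum over m, and (i+2)! = (i+2)(i+1)! matches the weights. If the weight is too small to hold the
unit, both sides vanish. -/
lemma sum_weightSet_mul_shift {n : ℕ} (i : Fin n) (l : ℕ) (f : (Fin (n + 1) → ℕ) → ℝ) :
    ∑ k ∈ weightSet (n + 1) l, (k i.castSucc : ℝ) * invWeight k *
        f (k - Pi.single i.castSucc 1 + Pi.single i.succ 1) =
      ∑ k ∈ weightSet (n + 1) (l + 1),
        (((i.succ : ℕ) + 1 : ℕ) : ℝ) * k i.succ * invWeight k * f k := by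
  by_cases hl : (i : ℕ) + 1 ≤ l
  · obtain ⟨p, rfl⟩ := Nat.exists_eq_add_of_le' hl
    have h1 := sum_weightSet_mul i.castSucc p
      (fun k => f (k - Pi.single i.castSucc 1 + Pi.single i.succ 1))
    have h2 := sum_weightSet_mul i.succ p (fun k => (((i.succ : ℕ) + 1 : ℕ) : ℝ) * f k)
    rw [Fin.val_castSucc] at h1
    rw [h1]
    refine Eq.trans (Finset.sum_congr rfl fun m _ => ?_) (h2.symm.trans ?_)
    · rw [add_tsub_cancel_right, Fin.val_succ, Nat.factorial_succ ((i : ℕ) + 1)]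
      have h3 : (((i : ℕ) + 1)! : ℝ) ≠ 0 := by positivity
      push_cast
      field_simp
    · rw [Fin.val_succ]
      refine Finset.sum_congr rfl fun m _ => by ring
  · rw [Finset.sum_eq_zero, Finset.sum_eq_zero]
    · intro k hk
      have := mul_le_of_mem_weightSet hk i.succ
      rw [Fin.val_succ] at this
      have : k i.succ = 0 := by
        by_contra h
        have := Nat.le_mul_of_pos_right ((i : ℕ) + 1 + 1) (Nat.pos_of_ne_zero h)
        omega
      simp [this]
    · intro k hk
      have := mul_le_of_mem_weightSet hk i.castSucc
      rw [Fin.val_castSucc] at this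
      have : k i.castSucc = 0 := by
        by_contra h
        have := Nat.le_mul_of_pos_right ((i : ℕ) + 1) (Nat.pos_of_ne_zero h)
        omega
      simp [this]

/-- The recursion satisfied by the coefficients in the formula of Faà di Bruno. -/
lemma sum_weightSet_succ {n l : ℕ} (f : (Fin (n + 1) → ℕ) → ℝ) :
    ∑ k ∈ weightSet (n + 1) l, (l ! * invWeight k) *
        (f (k + Pi.single 0 1) + ∑ i : Fin n, (k i.castSucc : ℝ) *
          f (k - Pi.single i.castSucc 1 + Pi.single i.succ 1)) =
      ∑ k ∈ weightSet (n + 1) (l + 1), ((l + 1)! * invWeight k) * f k := by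
  have h0 := sum_weightSet_mul (0 : Fin (n + 1)) l f
  simp only [Fin.val_zero, zero_add, Nat.factorial_one, Nat.cast_one, inv_one, mul_one] at h0
  calc _ = l ! * (∑ k ∈ weightSet (n + 1) l, invWeight k * f (k + Pi.single 0 1) +
        ∑ i : Fin n, ∑ k ∈ weightSet (n + 1) l, (k i.castSucc : ℝ) * invWeight k *
          f (k - Pi.single i.castSucc 1 + Pi.single i.succ 1)) := by
        rw [Finset.sum_comm, ← Finset.sum_add_distrib, Finset.mul_sum]
        refine Finset.sum_congr rfl fun k _ => ?_
        rw [mul_assoc, mul_add (invWeight k), Finset.mul_sum]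
        congr 2
        exact Finset.sum_congr rfl fun i _ => by ring
    _ = l ! * (∑ k ∈ weightSet (n + 1) (l + 1), (k 0 : ℝ) * invWeight k * f k +
        ∑ i : Fin n, ∑ k ∈ weightSet (n + 1) (l + 1),
          (((i.succ : ℕ) + 1 : ℕ) : ℝ) * k i.succ * invWeight k * f k) := by
        rw [h0]
        simp only [sum_weightSet_mul_shift]
    _ = _ := by
        rw [Finset.sum_comm, ← Finset.sum_add_distrib, Finset.mul_sum]
        refine Finset.sum_congr rfl fun k hk => ?_
        -- The collected multiplicities of a fixed k add up to its weight l + 1, which turns l! into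
        -- (l + 1)!.
        have hw : (((l + 1 : ℕ)) : ℝ) =
            k 0 + ∑ i : Fin n, (((i.succ : ℕ) + 1 : ℕ) : ℝ) * k i.succ := by
          conv_lhs => rw [← mem_weightSet.1 hk, Fin.sum_univ_succ]
          push_cast
          simp
        rw [← Finset.sum_mul, ← Finset.sum_mul, ← add_mul, ← add_mul, ← hw, Nat.factorial_succ]
        push_cast
        ring

/-- The sum in the formula of Faà di Bruno, with `n` variables. -/
noncomputable def brunoSum (n l : ℕ) (a : ℕ → ℝ) (x : ℕ → ℝ) : ℝ :=
  ∑ k ∈ weightSet n l, (l ! * invWeight k) * (a (∑ j, k j) * ∏ j : Fin n, x j ^ k j)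

lemma hasDerivAt_prod_pow {n : ℕ} (x : ℕ → ℝ → ℝ) (t : ℝ)
    (hx : ∀ j, HasDerivAt (x j) (x (j + 1) t) t) (k : Fin n → ℕ) :
    HasDerivAt (fun s => ∏ j : Fin n, x j s ^ k j)
      (∑ i : Fin n, (k i : ℝ) * (x i t ^ (k i - 1) * x (i + 1) t *
        ∏ j ∈ Finset.univ.erase i, x j t ^ k j)) t := by
  have := HasDerivAt.fun_finsetProd (u := Finset.univ) (f := fun (j : Fin n) s => x j s ^ k j)
    (f' := fun j : Fin n => k j * x j t ^ (k j - 1) * x (j + 1) t) (x := t)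
    (fun j _ => (hx j).pow (k j))
  refine this.congr_deriv ?_
  refine Finset.sum_congr rfl fun i _ => ?_
  simp only [smul_eq_mul]
  ring

lemma sum_add_single {n : ℕ} (m : Fin n → ℕ) (i : Fin n) :
    ∑ j, (m + Pi.single i 1 : Fin n → ℕ) j = ∑ j, m j + 1 := by
  simp [Finset.sum_add_distrib, Pi.single_apply]

/-- Keeping the number of variables fixed lets all orders share one family of sums. The chain rule
on `a` yields k + e_0 and the product rule yields k - e_i + e_{i+1}, the two shifts in
`sum_weightSet_succ`. -/
lemma hasDerivAt_brunoSum {n l : ℕ} (hl : l ≤ n) (a x : ℕ → ℝ → ℝ) (t : ℝ)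
    (ha : ∀ k ≤ l, HasDerivAt (a k) (a (k + 1) t * x 0 t) t)
    (hx : ∀ j, HasDerivAt (x j) (x (j + 1) t) t) :
    HasDerivAt (fun s => brunoSum (n + 1) l (fun k => a k s) (fun j => x j s))
      (brunoSum (n + 1) (l + 1) (fun k => a k t) (fun j => x j t)) t := by
  unfold brunoSum
  rw [← sum_weightSet_succ]
  refine HasDerivAt.fun_sum fun k hk => HasDerivAt.const_mul _ ?_
  refine ((ha _ (sum_le_of_mem_weightSet hk)).fun_mul
    (hasDerivAt_prod_pow x t hx k)).congr_deriv (Eq.symm ?_)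
  refine congrArg₂ (fun u v : ℝ => u + v) ?_ ?_
  · rw [prod_add_single (fun (j : Fin (n + 1)) e => x j t ^ e), sum_add_single,
      ← Finset.mul_prod_erase Finset.univ (fun j : Fin (n + 1) => x j t ^ k j) (Finset.mem_univ 0),
      pow_succ]
    simp only [Fin.val_zero]
    ring
  -- The last variable alone has weight n + 1 > l, so its derivative, which would need a further
  -- variable, never occurs.
  · have hlast : k (Fin.last n) = 0 := by
      by_contra h
      have h1 := mul_le_of_mem_weightSet hk (Fin.last n)
      have h2 := Nat.le_mul_of_pos_right (n + 1) (Nat.pos_of_ne_zero h)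
      rw [Fin.val_last] at h1
      omega
    rw [Fin.sum_univ_castSucc fun i : Fin (n + 1) => (k i : ℝ) * (x i t ^ (k i - 1) *
      x (i + 1) t * ∏ j ∈ Finset.univ.erase i, x j t ^ k j), hlast]
    simp only [Nat.cast_zero, zero_mul, add_zero]
    rw [Finset.mul_sum]
    refine Finset.sum_congr rfl fun i _ => ?_
    by_cases h0 : k i.castSucc = 0
    · simp [h0]
    obtain ⟨m, hm⟩ := exists_eq_add_single h0
    rw [hm, add_tsub_cancel_right, sum_add_single, sum_add_single,
      prod_add_single (fun (j : Fin (n + 1)) e => x j t ^ e)]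
    have he : ∏ j ∈ Finset.univ.erase i.castSucc, x j t ^ (m + Pi.single i.castSucc 1 : Fin (n + 1) → ℕ) j =
        ∏ j ∈ Finset.univ.erase i.castSucc, x j t ^ m j :=
      Finset.prod_congr rfl fun j hj => by simp [Pi.single_eq_of_ne (Finset.ne_of_mem_erase hj)]
    have h1 := Finset.mul_prod_erase Finset.univ (fun j : Fin (n + 1) => x j t ^ m j)
      (Finset.mem_univ i.succ)
    have h2 := Finset.mul_prod_erase Finset.univ (fun j : Fin (n + 1) => x j t ^ m j)
      (Finset.mem_univ i.castSucc)
    rw [he]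
    simp only [Pi.add_apply, Pi.single_eq_same, Nat.add_sub_cancel, Fin.val_succ,
      Fin.val_castSucc] at h1 h2 ⊢
    rw [pow_succ, mul_comm (x _ t ^ _) (x _ t), mul_assoc, h1, ← h2]
    ring

lemma weightSet_zero (n : ℕ) : weightSet n 0 = {0} := by
  ext k
  rw [mem_weightSet, Finset.mem_singleton, Finset.sum_eq_zero_iff]
  constructor
  · intro h
    ext j
    simpa using h j (Finset.mem_univ j)
  · rintro rfl j _
    simp

lemma brunoSum_zero (n : ℕ) (a x : ℕ → ℝ) : brunoSum n 0 a x = a 0 := by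
  simp [brunoSum, weightSet_zero, invWeight]

/-- The exponents balance: Z^(r - ∑k) from `a` times Z^(∑k) from the monomial. -/
lemma abs_brunoSum_le {n l r : ℕ} (hlr : l ≤ r) {a x : ℕ → ℝ} {K Z : ℝ}
    (ha : ∀ k ≤ r, |a k| ≤ K * Z ^ (r - k)) (hx : ∀ j < n, |x j| ≤ Z) :
    |brunoSum n l a x| ≤ (∑ k ∈ weightSet n l, |l ! * invWeight k|) * K * Z ^ r := by
  rw [brunoSum, Finset.sum_mul, Finset.sum_mul]
  refine (Finset.abs_sum_le_sum_abs _ _).trans (Finset.sum_le_sum fun k hk => ?_)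
  have hk' := (sum_le_of_mem_weightSet hk).trans hlr
  rw [abs_mul, abs_mul (a _), mul_assoc]
  refine mul_le_mul_of_nonneg_left ?_ (abs_nonneg _)
  have h1 : |∏ j : Fin n, x j ^ k j| ≤ Z ^ (∑ j, k j) := by
    rw [Finset.abs_prod, ← Finset.prod_pow_eq_pow_sum]
    refine Finset.prod_le_prod (fun j _ => abs_nonneg _) fun j _ => ?_
    rw [abs_pow]
    exact pow_le_pow_left₀ (abs_nonneg _) (hx j j.2) _
  calc _ ≤ (K * Z ^ (r - ∑ j, k j)) * Z ^ (∑ j, k j) :=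
        mul_le_mul (ha _ hk') h1 (abs_nonneg _) ((abs_nonneg _).trans (ha _ hk'))
    _ = K * Z ^ r := by rw [mul_assoc, ← pow_add, Nat.sub_add_cancel hk']

/-! ### Derivatives of φ(X) and their integrable majorant. -/

/-- The `l`-th derivative of `φ` of the coding map in the parameter `l₁`, in terms of the first
`n` derivatives of the coding map. -/
noncomputable def derivComp (n : ℕ) (phi : ℝ → ℝ) (l₂ d₁ d₂ : ℝ) (l : ℕ) (t : ℝ)
    (ω : ℕ → Fin 2) : ℝ :=
  brunoSum n l (fun k => iteratedDeriv k phi (derivX t l₂ d₁ d₂ 0 ω))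
    (fun j => derivX t l₂ d₁ d₂ (j + 1) ω)

lemma derivComp_zero (n : ℕ) (phi : ℝ → ℝ) (l₂ d₁ d₂ t : ℝ) (ω : ℕ → Fin 2) :
    derivComp n phi l₂ d₁ d₂ 0 t ω = phi (codingX t l₂ d₁ d₂ ω) := by
  rw [derivComp, brunoSum_zero, iteratedDeriv_zero, derivX_zero]

lemma measurable_derivComp {n r l : ℕ} (hl : l ≤ r) {phi : ℝ → ℝ}
    (hphi : ContDiff ℝ (r : ℕ∞) phi) (l₂ d₁ d₂ t : ℝ) :
    Measurable (derivComp n phi l₂ d₁ d₂ l t) := by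
  unfold derivComp brunoSum
  refine Finset.measurable_sum _ fun k hk => Measurable.const_mul (Measurable.mul ?_ ?_) _
  · refine (hphi.continuous_iteratedDeriv _ ?_).measurable.comp (measurable_derivX _ _ _ _ 0)
    exact WithTop.coe_le_coe.2 (Nat.cast_le.2 ((sum_le_of_mem_weightSet hk).trans hl))
  · exact Finset.measurable_prod _ fun j _ => (measurable_derivX _ _ _ _ _).pow_const _

lemma derivComp_eq_formalDerivative {a b l₂ : ℝ} {ω : ℕ → Fin 2} (ha : 0 < a) (hab : a < b)
    (hl₂ : 0 < l₂) (d₁ d₂ : ℝ) (h : Summable fun m => wordProd b l₂ m ω) (phi : ℝ → ℝ) (l : ℕ)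
    {t : ℝ} (ht : t ∈ Set.Ioo 0 a) :
    derivComp l phi l₂ d₁ d₂ l t ω = formalDerivative t l₂ d₁ d₂ phi l ω := by
  simp only [derivComp, brunoSum, formalDerivative, derivX_zero, brunoCoeff_eq,
    derivX_eq_formalX ha hab hl₂ d₁ d₂ h (Nat.le_add_left 1 _) ht, weightSet, bruno, mul_assoc]

lemma hasDerivAt_derivComp {a b l₂ : ℝ} {ω : ℕ → Fin 2} (ha : 0 < a) (hab : a < b)
    (hl₂ : 0 < l₂) (d₁ d₂ : ℝ) (h : Summable fun m => wordProd b l₂ m ω) {r : ℕ} {phi : ℝ → ℝ}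
    (hphi : ContDiff ℝ (r : ℕ∞) phi) {n l : ℕ} (hln : l < n) (hlr : l < r) {t : ℝ}
    (ht : t ∈ Set.Ioo 0 a) :
    HasDerivAt (fun s => derivComp n phi l₂ d₁ d₂ l s ω)
      (derivComp n phi l₂ d₁ d₂ (l + 1) t ω) t := by
  obtain ⟨n, rfl⟩ := Nat.exists_eq_succ_of_ne_zero (Nat.ne_zero_of_lt hln)
  refine hasDerivAt_brunoSum (Nat.le_of_lt_succ hln)
    (fun k s => iteratedDeriv k phi (derivX s l₂ d₁ d₂ 0 ω))
    (fun j s => derivX s l₂ d₁ d₂ (j + 1) ω) t (fun k hk => ?_)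
    (fun j => hasDerivAt_derivX ha hab hl₂ d₁ d₂ h (j + 1) ht)
  have h1 : HasDerivAt (iteratedDeriv k phi)
      (iteratedDeriv (k + 1) phi (derivX t l₂ d₁ d₂ 0 ω)) (derivX t l₂ d₁ d₂ 0 ω) := by
    rw [iteratedDeriv_succ]
    exact (hphi.differentiable_iteratedDeriv k
      (WithTop.coe_lt_coe.2 (Nat.cast_lt.2 (hk.trans_lt hlr))) _).hasDerivAt
  exact h1.comp t (hasDerivAt_derivX ha hab hl₂ d₁ d₂ h 0 ht)

lemma exists_integrable_bound_derivComp {a b l₂ : ℝ} (ha : 0 < a) (hab : a < b) (hl₂ : 0 < l₂)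
    (d₁ d₂ : ℝ) {r : ℕ} (hr : r ≠ 0) (hq : (b ^ r + l₂ ^ r) / 2 < 1) {phi : ℝ → ℝ}
    (hphi : ContDiff ℝ (r : ℕ∞) phi) (hb : ∃ M : ℝ, ∀ x, |iteratedDeriv r phi x| ≤ M) (n : ℕ) :
    ∃ B : ℕ → (ℕ → Fin 2) → ℝ, ∀ l ≤ r, Integrable (B l) bernoulliMeasure ∧
      ∀ t ∈ Set.Ioo 0 a, ∀ ω : ℕ → Fin 2, (Summable fun m => wordProd b l₂ m ω) →
        ‖derivComp n phi l₂ d₁ d₂ l t ω‖ ≤ B l ω := by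
  have hb0 : 0 < b := ha.trans hab
  obtain ⟨K, hK, hphiK⟩ := exists_abs_iteratedDeriv_le hphi hb
  choose C hC0 hC using exists_norm_derivX_le ha hab hl₂ d₁ d₂
  -- D is at least 1 and every C_j, so Z = D(1 + W) bounds both 1 + |X| and all the derivatives of X
  -- at once.
  set D : ℝ := 1 + ∑ j ∈ Finset.range (n + 1), C j with hD
  have hsum : 0 ≤ ∑ j ∈ Finset.range (n + 1), C j := Finset.sum_nonneg fun j _ => hC0 j
  have hD1 : 1 ≤ D := by linarith
  have hCD : ∀ j ≤ n, C j ≤ D := fun j hj => by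
    have := Finset.single_le_sum (f := C) (fun j _ => hC0 j)
      (Finset.mem_range.2 (Nat.lt_succ_of_le hj))
    linarith
  refine ⟨fun l ω => (∑ k ∈ weightSet n l, |l ! * invWeight k|) * K *
    (D * (1 + ∑' m, wordProd b l₂ m ω)) ^ r, fun l hl => ⟨?_, fun t ht ω h => ?_⟩⟩
  · refine Integrable.const_mul ?_ _
    have h1 := (((memLp_const (1 : ℝ)).add (memLp_tsum_wordProd hb0 hl₂ hr hq)).const_mul
      D).integrable_norm_pow hr
    refine h1.congr (ae_of_all _ fun ω => ?_)
    have h0 : 0 ≤ ∑' m, wordProd b l₂ m ω := tsum_nonneg fun m => (wordProd_pos hb0 hl₂ m ω).le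
    have h2 : 0 ≤ D * (1 + ∑' m, wordProd b l₂ m ω) := by positivity
    simp only [Pi.add_apply]
    rw [Real.norm_of_nonneg h2]
  · have h0 : 0 ≤ ∑' m, wordProd b l₂ m ω := tsum_nonneg fun m => (wordProd_pos hb0 hl₂ m ω).le
    have hx : ∀ j ≤ n, |derivX t l₂ d₁ d₂ j ω| ≤ D * ∑' m, wordProd b l₂ m ω := fun j hj =>
      (hC j t ht ω h).trans (mul_le_mul_of_nonneg_right (hCD j hj) h0)
    refine abs_brunoSum_le hl (fun k hk => (hphiK k hk _).trans ?_)
      fun j hj => (hx (j + 1) hj).trans (by gcongr; linarith)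
    gcongr
    have := hx 0 (Nat.zero_le n)
    linarith

/-! ### Assembly: differentiation under the integral. -/

theorem mainTheorem2 (r : ℕ) (l₁ l₂ d₁ d₂ : ℝ) (hl₁ : 0 < l₁) (hl₁' : l₁ < 1) (hl₂ : 1 < l₂)
    (hr : (l₁ ^ r + l₂ ^ r) / 2 < 1)
    (phi : ℝ → ℝ) (hphi : ContDiff ℝ (r : ℕ∞) phi) (hb : ∃ M : ℝ, ∀ x, |iteratedDeriv r phi x| ≤ M) :
    -- near `ε = 0` the stationary measure exists, is unique, and integrates `φ`
    (∀ᶠ ε in 𝓝 (0 : ℝ), (∃! μ : Measure ℝ, IsStationaryMeasure (l₁ + ε) l₂ d₁ d₂ μ) ∧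
      Integrable phi (stationaryMeasure (l₁ + ε) l₂ d₁ d₂)) ∧
    -- for almost every word the series `X(ε)` converges for small `ε`; its derivatives at `0` are
    -- the convergent series `X^{(j)}`; and `φ(X(ε))` is differentiable at `0` up to order `r`
    (∀ᵐ ω ∂bernoulliMeasure,
      (∀ᶠ ε in 𝓝 (0 : ℝ),
        Summable (fun m => wordProd (l₁ + ε) l₂ m ω * (![d₁, d₂] : Fin 2 → ℝ) (ω m))) ∧
      (∀ j : ℕ, 1 ≤ j →
        Summable (fun m => formalTerm l₁ l₂ d₁ d₂ j (m + 1) ω) ∧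
        DifferentiableUpToAt j (fun ε => codingX (l₁ + ε) l₂ d₁ d₂ ω) 0 ∧
        iteratedDeriv j (fun ε => codingX (l₁ + ε) l₂ d₁ d₂ ω) 0 = formalX l₁ l₂ d₁ d₂ j ω) ∧
      DifferentiableUpToAt r (fun ε => phi (codingX (l₁ + ε) l₂ d₁ d₂ ω)) 0) ∧
    -- `h(ε) = ∫ φ dμ_{l₁ + ε, l₂}` is differentiable at `0` up to order `r`
    DifferentiableUpToAt r (fun ε => ∫ x, phi x ∂(stationaryMeasure (l₁ + ε) l₂ d₁ d₂)) 0 ∧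
    -- and its derivatives at `0` are given by both formulas
    ∀ l : ℕ, 1 ≤ l → l ≤ r →
      Integrable (fun ω => iteratedDeriv l (fun ε => phi (codingX (l₁ + ε) l₂ d₁ d₂ ω)) 0)
        bernoulliMeasure ∧
      Integrable (fun ω => formalDerivative l₁ l₂ d₁ d₂ phi l ω) bernoulliMeasure ∧
      iteratedDeriv l (fun ε => ∫ x, phi x ∂(stationaryMeasure (l₁ + ε) l₂ d₁ d₂)) 0 =
        ∫ ω, iteratedDeriv l (fun ε => phi (codingX (l₁ + ε) l₂ d₁ d₂ ω)) 0 ∂bernoulliMeasure ∧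
      iteratedDeriv l (fun ε => ∫ x, phi x ∂(stationaryMeasure (l₁ + ε) l₂ d₁ d₂)) 0 =
        ∫ ω, formalDerivative l₁ l₂ d₁ d₂ phi l ω ∂bernoulliMeasure := by
  -- For r = 0 the mean of the powers is exactly 1.
  have hr0 : r ≠ 0 := by
    rintro rfl
    norm_num at hr
  have hl₂0 : 0 < l₂ := one_pos.trans hl₂
  obtain ⟨b, hb₁, hq⟩ : ∃ b, l₁ < b ∧ (b ^ r + l₂ ^ r) / 2 < 1 := by
    have hc : ContinuousAt (fun x : ℝ => (x ^ r + l₂ ^ r) / 2) l₁ := by fun_prop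
    have h1 : ∀ᶠ x in 𝓝[>] l₁, (x ^ r + l₂ ^ r) / 2 < 1 :=
      (hc.eventually_lt_const hr).filter_mono nhdsWithin_le_nhds
    exact ((eventually_mem_nhdsWithin (a := l₁) (s := Set.Ioi l₁)).and h1).exists
  obtain ⟨a, ha₁, hab⟩ := exists_between hb₁
  have ha0 : 0 < a := hl₁.trans ha₁
  have hb0 : 0 < b := ha0.trans hab
  -- The parameters with l₁ + ε in (0, a), where the bounds in terms of b are uniform.
  set s : Set ℝ := Set.Ioo (-l₁) (a - l₁) with hs
  have hso : IsOpen s := isOpen_Ioo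
  have hs0 : (0 : ℝ) ∈ s := ⟨by linarith, by linarith⟩
  have hst : ∀ ε ∈ s, l₁ + ε ∈ Set.Ioo 0 a := fun ε hε => ⟨by linarith [hε.1], by linarith [hε.2]⟩
  have hsum := ae_summable_wordProd hb0 hl₂0 hr0 hq
  have hsum' : ∀ ε ∈ s, ∀ᵐ ω ∂bernoulliMeasure, Summable fun m => wordProd (l₁ + ε) l₂ m ω :=
    fun ε hε => hsum.mono fun ω =>
      summable_wordProd_of_le (hst ε hε).1 ((hst ε hε).2.le.trans hab.le) hl₂0
  have hphic : Continuous phi := hphi.continuous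
  have hderivX : ∀ ω : ℕ → Fin 2, (Summable fun m => wordProd b l₂ m ω) → ∀ n, ∀ ε ∈ s,
      HasDerivAt (fun ε => derivX (l₁ + ε) l₂ d₁ d₂ n ω)
        (derivX (l₁ + ε) l₂ d₁ d₂ (n + 1) ω) ε := fun ω h n ε hε =>
    HasDerivAt.comp_const_add l₁ ε (hasDerivAt_derivX ha0 hab hl₂0 d₁ d₂ h n (hst ε hε))
  have hcomp : ∀ N, ∀ ω : ℕ → Fin 2, (Summable fun m => wordProd b l₂ m ω) →
      ∀ n < N, n < r → ∀ ε ∈ s, HasDerivAt (fun ε => derivComp N phi l₂ d₁ d₂ n (l₁ + ε) ω)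
        (derivComp N phi l₂ d₁ d₂ (n + 1) (l₁ + ε) ω) ε := fun N ω h n hnN hnr ε hε =>
    HasDerivAt.comp_const_add l₁ ε
      (hasDerivAt_derivComp ha0 hab hl₂0 d₁ d₂ h hphi hnN hnr (hst ε hε))
  have hzero : ∀ N, ∀ ω, Set.EqOn (fun ε => phi (codingX (l₁ + ε) l₂ d₁ d₂ ω))
      (fun ε => derivComp N phi l₂ d₁ d₂ 0 (l₁ + ε) ω) s := fun N ω ε _ =>
    (derivComp_zero N phi l₂ d₁ d₂ (l₁ + ε) ω).symm
  -- With r variables the sums are closed under differentiation up to order r.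
  obtain ⟨B, hB⟩ := exists_integrable_bound_derivComp ha0 hab hl₂0 d₁ d₂ hr0 hq hphi hb r
  have hint : ∀ l ≤ r, ∀ ε ∈ s,
      Integrable (derivComp r phi l₂ d₁ d₂ l (l₁ + ε)) bernoulliMeasure := fun l hl ε hε =>
    (hB l hl).1.mono' (measurable_derivComp hl hphi _ _ _ _).aestronglyMeasurable
      (hsum.mono fun ω hω => (hB l hl).2 _ (hst ε hε) ω hω)
  have hH : ∀ l < r, ∀ ε ∈ s,
      HasDerivAt (fun ε => ∫ ω, derivComp r phi l₂ d₁ d₂ l (l₁ + ε) ω ∂bernoulliMeasure)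
        (∫ ω, derivComp r phi l₂ d₁ d₂ (l + 1) (l₁ + ε) ω ∂bernoulliMeasure) ε :=
    fun l hl ε hε => (hasDerivAt_integral_of_dominated_loc_of_deriv_le
      (F := fun ε ω => derivComp r phi l₂ d₁ d₂ l (l₁ + ε) ω)
      (F' := fun ε ω => derivComp r phi l₂ d₁ d₂ (l + 1) (l₁ + ε) ω) (bound := B (l + 1))
      (hso.mem_nhds hε)
      (.of_forall fun _ => (measurable_derivComp hl.le hphi _ _ _ _).aestronglyMeasurable)
      (hint l hl.le ε hε) (measurable_derivComp hl hphi _ _ _ _).aestronglyMeasurable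
      (hsum.mono fun ω hω ε' hε' => (hB (l + 1) hl).2 _ (hst ε' hε') ω hω) (hB (l + 1) hl).1
      (hsum.mono fun ω hω ε' hε' => hcomp r ω hω l hl hl ε' hε')).2
  have hstat : ∀ ε ∈ s, stationaryMeasure (l₁ + ε) l₂ d₁ d₂ =
      bernoulliMeasure.map (codingX (l₁ + ε) l₂ d₁ d₂) := fun ε hε =>
    stationaryMeasure_eq_map_codingX (hst ε hε).1 hl₂0 d₁ d₂ (hsum' ε hε)
  have hH0 : Set.EqOn (fun ε => ∫ x, phi x ∂(stationaryMeasure (l₁ + ε) l₂ d₁ d₂))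
      (fun ε => ∫ ω, derivComp r phi l₂ d₁ d₂ 0 (l₁ + ε) ω ∂bernoulliMeasure) s := fun ε hε => by
    simp only [hstat ε hε, derivComp_zero]
    exact integral_map (measurable_codingX _ _ _ _).aemeasurable hphic.aestronglyMeasurable
  refine ⟨?_, ?_, ?_, ?_⟩
  · filter_upwards [hso.mem_nhds hs0] with ε hε
    refine ⟨existsUnique_isStationaryMeasure (hst ε hε).1 hl₂0 d₁ d₂ (hsum' ε hε), ?_⟩
    rw [hstat ε hε, integrable_map_measure hphic.aestronglyMeasurable
      (measurable_codingX _ _ _ _).aemeasurable]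
    refine (hint 0 (Nat.zero_le r) ε hε).congr (ae_of_all _ fun ω => ?_)
    exact derivComp_zero r phi l₂ d₁ d₂ (l₁ + ε) ω
  · filter_upwards [hsum] with ω hω
    have hX0 : Set.EqOn (fun ε => codingX (l₁ + ε) l₂ d₁ d₂ ω)
        (fun ε => derivX (l₁ + ε) l₂ d₁ d₂ 0 ω) s := fun ε _ => (derivX_zero _ _ _ _ _).symm
    refine ⟨?_, fun j hj => ⟨?_, ?_, ?_⟩, ?_⟩
    · filter_upwards [hso.mem_nhds hs0] with ε hε
      exact summable_codingX (hst ε hε).1 hl₂0 d₁ d₂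
        (summable_wordProd_of_le (hst ε hε).1 ((hst ε hε).2.le.trans hab.le) hl₂0 hω)
    · exact (summable_nat_add_iff 1).2 (summable_formalTerm ha0 hab hl₂0 d₁ d₂ hω j ⟨hl₁, ha₁⟩)
    · exact differentiableUpToAt_of_hasDerivAt hso
        (G := fun n ε => derivX (l₁ + ε) l₂ d₁ d₂ n ω) (fun n _ => hderivX ω hω n) hX0 hs0
    · rw [eqOn_iteratedDeriv_of_hasDerivAt hso (r := j)
        (G := fun n ε => derivX (l₁ + ε) l₂ d₁ d₂ n ω) (fun n _ => hderivX ω hω n) hX0 j le_rfl hs0]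
      simp only [add_zero]
      exact derivX_eq_formalX ha0 hab hl₂0 d₁ d₂ hω hj ⟨hl₁, ha₁⟩
    · exact differentiableUpToAt_of_hasDerivAt hso
        (G := fun n ε => derivComp r phi l₂ d₁ d₂ n (l₁ + ε) ω)
        (fun n hn => hcomp r ω hω n hn hn) (hzero r ω) hs0
  · exact differentiableUpToAt_of_hasDerivAt hso
      (G := fun n ε => ∫ ω, derivComp r phi l₂ d₁ d₂ n (l₁ + ε) ω ∂bernoulliMeasure) hH hH0 hs0
  · intro l _ hl
    have hder : ∀ᵐ ω ∂bernoulliMeasure, derivComp r phi l₂ d₁ d₂ l (l₁ + 0) ω =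
        iteratedDeriv l (fun ε => phi (codingX (l₁ + ε) l₂ d₁ d₂ ω)) 0 := by
      filter_upwards [hsum] with ω hω
      exact (eqOn_iteratedDeriv_of_hasDerivAt hso
        (G := fun n ε => derivComp r phi l₂ d₁ d₂ n (l₁ + ε) ω)
        (fun n hn => hcomp r ω hω n hn hn) (hzero r ω) l hl hs0).symm
    have hform : ∀ᵐ ω ∂bernoulliMeasure, derivComp r phi l₂ d₁ d₂ l (l₁ + 0) ω =
        formalDerivative l₁ l₂ d₁ d₂ phi l ω := by
      filter_upwards [hsum, hder] with ω hω h
      -- `formalDerivative` has l variables, not r. Both versions compute the same iterated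
      -- derivative, so no comparison of index sets is needed.
      rw [h, eqOn_iteratedDeriv_of_hasDerivAt hso (r := l)
        (G := fun n ε => derivComp l phi l₂ d₁ d₂ n (l₁ + ε) ω)
        (fun n hn => hcomp l ω hω n hn (hn.trans_le hl)) (hzero l ω) l le_rfl hs0]
      simp only [add_zero]
      exact derivComp_eq_formalDerivative ha0 hab hl₂0 d₁ d₂ hω phi l ⟨hl₁, ha₁⟩
    rw [eqOn_iteratedDeriv_of_hasDerivAt hso
      (G := fun n ε => ∫ ω, derivComp r phi l₂ d₁ d₂ n (l₁ + ε) ω ∂bernoulliMeasure) hH hH0 l hl hs0]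
    exact ⟨(hint l hl 0 hs0).congr hder, (hint l hl 0 hs0).congr hform,
      integral_congr_ae hder, integral_congr_ae hform⟩
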